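/- Let $A$ be a real symmetric positive semidefinite $n\times n$ matrix of rank $r$, let $E$ be a real symmetric $n\times n$ matrix, and put $\tilde A = A+E$. Let $\sigma_1\ge\sigma_2\ge\dots$ be the singular values of $A$ (with $\sigma_k=0$ for $k>r$), let $A=\sum_{i=1}^r\sigma_i u_i v_i^\top$ be any singular value decomposition of $A$, with $(u_i)$ and $(v_i)$ orthonormal (since $A$ is positive semidefinite, $u_i=v_i$ is an eigenvector for the eigenvalue $\sigma_i$), and put $$x=\max_{1\le i,j\le r}|u_i^\top E v_j|,\qquad y=\max_{1\le i<j\le r}\max\{|Ev_i\cdot Ev_j|,\ |E^\top u_i\cdot E^\top u_j|\}$$ (with $y=0$ if $r=1$). Let $1\le p\le r$, let $\delta_p=\sigma_p-\sigma_{p+1}$ and assume $\delta_p>0$. Let $A_p=\sum_{i=1}^p\sigma_i u_i v_i^\top$, and let $\tilde A_p$ be the sum of the $p$ leading terms (those with the $p$ largest singular values; all terms if there are fewer than $p$) of any singular value decomposition of $\tilde A$. Let $\|\cdot\|$ denote the spectral norm. If $$\max\left\{\frac{p\|E\|}{\sigma_p},\ \frac{r^2x}{\delta_p},\ \frac{\sqrt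 r\,\|E\|}{\sqrt{\sigma_p\delta_p}}\right\}\le\frac1{24},$$ then $$\|\tilde A_p-A_p\|\le 8\sigma_p\left(\frac{\|E\|}{\sigma_p}+\frac{rx}{\delta_p}+\frac{r^2y}{\sigma_p\delta_p}\right).$$ -/

import Mathlib

open scoped Matrix Matrix.Norms.L2Operator

noncomputable section

namespace LowRank

/-- The `k`-th largest singular value `σ_k` of `M`, counted from `k = 1` and with multiplicity
(`k = 0` is never used). It is `0` for `k > rank M`. -/
def sv {m n : ℕ} (M : Matrix (Fin m) (Fin n) ℝ) (k : ℕ) : ℝ :=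
  (Matrix.toEuclideanLin M).singularValues (k - 1)

/-- The singular value gap `δ_k = σ_k - σ_{k+1}`. -/
def gap {m n : ℕ} (M : Matrix (Fin m) (Fin n) ℝ) (k : ℕ) : ℝ :=
  sv M k - sv M (k + 1)

/-- A singular value decomposition `M = ∑_{i=1}^r σ_i u_i v_iᵀ`, where `r` is the rank of `M`,
the `σ_i` are its nonzero singular values in decreasing order, and `(u_i)`, `(v_i)` are
orthonormal families. The index `i : Fin r` stands for the usual index `i + 1`. -/
structure SVD {m n : ℕ} (M : Matrix (Fin m) (Fin n) ℝ) where
  /-- left singular vectors -/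
  u : Fin M.rank → EuclideanSpace ℝ (Fin m)
  /-- right singular vectors -/
  v : Fin M.rank → EuclideanSpace ℝ (Fin n)
  orthonormal_u : Orthonormal ℝ u
  orthonormal_v : Orthonormal ℝ v
  decomp : M = ∑ i : Fin M.rank, sv M ((i : ℕ) + 1) • Matrix.vecMulVec (u i).ofLp (v i).ofLp

variable {m n : ℕ} {M : Matrix (Fin m) (Fin n) ℝ}

/-- The best rank `p` approximation `M_p = ∑_{i ≤ p} σ_i u_i v_iᵀ`. -/
def SVD.approx (S : SVD M) (p : ℕ) : Matrix (Fin m) (Fin n) ℝ :=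
  ∑ i ∈ Finset.univ.filter (fun i : Fin M.rank => (i : ℕ) < p),
    sv M ((i : ℕ) + 1) • Matrix.vecMulVec (S.u i).ofLp (S.v i).ofLp

/-- The skewness parameter `x = max_{1 ≤ i, j ≤ r} |u_iᵀ E v_j|`. -/
def SVD.x (S : SVD M) (E : Matrix (Fin m) (Fin n) ℝ) : ℝ :=
  ⨆ q : Fin M.rank × Fin M.rank, |(S.u q.1).ofLp ⬝ᵥ (E *ᵥ (S.v q.2).ofLp)|

/-- The skewness parameter `y = max_{1 ≤ i < j ≤ r} {|E v_i · E v_j|, |Eᵀ u_i · Eᵀ u_j|}`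
(the maximum over no pairs, for `r ≤ 1`, is `0`). -/
def SVD.y (S : SVD M) (E : Matrix (Fin m) (Fin n) ℝ) : ℝ :=
  ⨆ q : {q : Fin M.rank × Fin M.rank // q.1 < q.2},
    max |(E *ᵥ (S.v q.1.1).ofLp) ⬝ᵥ (E *ᵥ (S.v q.1.2).ofLp)|
      |(Eᵀ *ᵥ (S.u q.1.1).ofLp) ⬝ᵥ (Eᵀ *ᵥ (S.u q.1.2).ofLp)|

end LowRank

end

/-! Let `P`, `N`, `K` project onto the first `p` left singular vectors of `A`, onto the other ones,
and onto the complement of the column space. Let `Q` project onto the first `p` left singular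
vectors of `Ã`, and let `B` be the pseudoinverse of `Ã_p`, so that `(A + E) B = Q`; the right-hand
side has the same notation. Only the compression of `E` to the singular subspaces of `A` can lower
the leading singular values, so `‖B‖ ≤ β = 1 / (σ_p - r x)` (`sub_le_singularValue`).

The heart is a bound for `N Q = N (A + E) B` (`norm_rest_mul_le`). The term with `A` returns the
analogous quantity on the right with factor at most `σ_{p+1}`, and `E` on the row space costs `r x`.
The kernel of `A` is reached only through `Eᵀ`; expanding once more there gives cross entries of `E
Eᵀ`, which cost `r y`, a term `(r x)²`, a term `‖E‖² ‖N Q‖` and a remainder of order `‖E‖³`. The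
larger `m` of the left and right quantities thus satisfies a linear inequality, and the gap allows
it to be solved: `δ_p m` is at most a constant times `r x + r y / σ_p`, plus a small multiple of
`δ_p ‖E‖ / σ_p` (`leading_error_bound`).

In `Ã_p - A_p` the subspace errors appear only multiplied by discarded parts of `A` or `Ã`, of norm
at most `σ_{p+1} + ‖E‖` (`norm_sub_leading_le`), so the kernel components cost no more than a
multiple of `‖E‖`. -/

noncomputable section

namespace LowRank

open InnerProductSpace

/-! ### Calculus of singular value sums and projections onto orthonormal families. -/

section SvdSum

variable {H ι κ : Type*} [NormedAddCommGroup H] [InnerProductSpace ℝ H]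

/-- The operator `∑_{i ∈ I} c_i u_i v_iᵀ`. -/
def svdSum (u v : ι → H) (c : ι → ℝ) (I : Finset ι) : H →L[ℝ] H :=
  ∑ i ∈ I, c i • rankOne ℝ (u i) (v i)

/-- The operator `∑_{i ∈ I} u_i u_iᵀ`, the orthogonal projection onto the span of `u_i`, `i ∈ I`,
when `u` is orthonormal. -/
def famProj (u : ι → H) (I : Finset ι) : H →L[ℝ] H := svdSum u u 1 I

theorem svdSum_apply (u v : ι → H) (c : ι → ℝ) (I : Finset ι) (z : H) :
    svdSum u v c I z = ∑ i ∈ I, (c i * inner ℝ (v i) z) • u i := by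
  simp [svdSum, smul_smul]

theorem famProj_apply (u : ι → H) (I : Finset ι) (z : H) :
    famProj u I z = ∑ i ∈ I, inner ℝ (u i) z • u i := by
  simp [famProj, svdSum_apply]

theorem star_svdSum [CompleteSpace H] (u v : ι → H) (c : ι → ℝ) (I : Finset ι) :
    star (svdSum u v c I) = svdSum v u c I := by
  simp [svdSum, star_sum, ContinuousLinearMap.star_eq_adjoint]

theorem star_famProj [CompleteSpace H] (u : ι → H) (I : Finset ι) :
    star (famProj u I) = famProj u I :=
  star_svdSum u u 1 I

theorem inner_svdSum [DecidableEq ι] {v : ι → H} (w : ι → H) (hv : Orthonormal ℝ v) (d : ι → ℝ)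
    (J : Finset ι) (i : ι) (z : H) :
    inner ℝ (v i) (svdSum v w d J z) = if i ∈ J then d i * inner ℝ (w i) z else 0 := by
  simp [svdSum_apply, inner_sum, inner_smul_right, orthonormal_iff_ite.mp hv]

theorem svdSum_mul_svdSum [DecidableEq ι] (u : ι → H) {v : ι → H} (w : ι → H)
    (hv : Orthonormal ℝ v) (c d : ι → ℝ) (I J : Finset ι) :
    svdSum u v c I * svdSum v w d J = svdSum u w (c * d) (I ∩ J) := by
  ext z
  rw [mul_apply_eq_comp, svdSum_apply u v, svdSum_apply u w,
    ← Finset.filter_mem_eq_inter, Finset.sum_filter]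
  refine Finset.sum_congr rfl fun i _ => ?_
  rw [inner_svdSum w hv]
  split_ifs <;> simp [mul_assoc]

theorem svdSum_mul_famProj [DecidableEq ι] (u : ι → H) {v : ι → H}
    (hv : Orthonormal ℝ v) (c : ι → ℝ) (I J : Finset ι) :
    svdSum u v c I * famProj v J = svdSum u v c (I ∩ J) := by
  rw [famProj, svdSum_mul_svdSum u v hv, mul_one]

theorem famProj_mul_svdSum [DecidableEq ι] {u : ι → H} (v : ι → H)
    (hu : Orthonormal ℝ u) (c : ι → ℝ) (I J : Finset ι) :
    famProj u I * svdSum u v c J = svdSum u v c (I ∩ J) := by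
  rw [famProj, svdSum_mul_svdSum u v hu, one_mul]

theorem famProj_mul_famProj [DecidableEq ι] {u : ι → H} (hu : Orthonormal ℝ u) (I J : Finset ι) :
    famProj u I * famProj u J = famProj u (I ∩ J) :=
  famProj_mul_svdSum u hu 1 I J

theorem isStarProjection_famProj [CompleteSpace H] {u : ι → H} (hu : Orthonormal ℝ u)
    (I : Finset ι) : IsStarProjection (famProj u I) := by
  classical
  exact ⟨by rw [IsIdempotentElem, famProj_mul_famProj hu, Finset.inter_self], star_famProj u I⟩

theorem norm_sum_smul_sq {u : ι → H} (hu : Orthonormal ℝ u) (l : ι → ℝ) (I : Finset ι) :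
    ‖∑ i ∈ I, l i • u i‖ ^ 2 = ∑ i ∈ I, l i ^ 2 := by
  rw [← real_inner_self_eq_norm_sq, hu.inner_sum]
  simp [sq]

theorem sum_inner_sq_le {v : ι → H} (hv : Orthonormal ℝ v) (I : Finset ι) (z : H) :
    ∑ i ∈ I, inner ℝ (v i) z ^ 2 ≤ ‖z‖ ^ 2 := by
  simpa using hv.sum_inner_products_le z (s := I)

theorem norm_svdSum_le {u v : ι → H} (hu : Orthonormal ℝ u) (hv : Orthonormal ℝ v) {c : ι → ℝ}
    {I : Finset ι} {C : ℝ} (hC : 0 ≤ C) (hc : ∀ i ∈ I, |c i| ≤ C) :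
    ‖svdSum u v c I‖ ≤ C := by
  refine ContinuousLinearMap.opNorm_le_bound _ hC fun z => ?_
  refine le_of_sq_le_sq ?_ (by positivity)
  rw [svdSum_apply, norm_sum_smul_sq hu, mul_pow]
  calc ∑ i ∈ I, (c i * inner ℝ (v i) z) ^ 2 ≤ ∑ i ∈ I, C ^ 2 * inner ℝ (v i) z ^ 2 := by
        refine Finset.sum_le_sum fun i hi => ?_
        rw [mul_pow]
        exact mul_le_mul_of_nonneg_right (sq_le_sq' (neg_le_of_abs_le (hc i hi))
          (le_of_abs_le (hc i hi))) (sq_nonneg _)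
    _ ≤ C ^ 2 * ‖z‖ ^ 2 := by
        rw [← Finset.mul_sum]
        exact mul_le_mul_of_nonneg_left (sum_inner_sq_le hv I z) (sq_nonneg _)

theorem norm_famProj_le {u : ι → H} (hu : Orthonormal ℝ u) (I : Finset ι) :
    ‖famProj u I‖ ≤ 1 :=
  norm_svdSum_le hu hu zero_le_one (by simp)

/-- Lower half of the min-max comparison of singular values; `norm_svdSum_apply_le_of_inner_eq_zero`
is the upper half. -/
theorem mul_norm_le_norm_svdSum [Fintype ι] {u v : ι → H} (hu : Orthonormal ℝ u)
    (hv : Orthonormal ℝ v) {c : ι → ℝ} {I : Finset ι} {C : ℝ} (hC : 0 ≤ C)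
    (hc : ∀ i ∈ I, C ≤ c i) {w : H} (hw : famProj v I w = w) :
    C * ‖w‖ ≤ ‖svdSum u v c Finset.univ w‖ := by
  classical
  have h : svdSum u v c Finset.univ w = svdSum u v c I w := by
    conv_lhs => rw [← hw]
    rw [← mul_apply_eq_comp, svdSum_mul_famProj u hv, Finset.univ_inter]
  rw [h]
  refine le_of_sq_le_sq ?_ (norm_nonneg _)
  conv_lhs => rw [← hw]
  rw [svdSum_apply, famProj_apply, mul_pow, norm_sum_smul_sq hu, norm_sum_smul_sq hv,
    Finset.mul_sum]
  refine Finset.sum_le_sum fun i hi => ?_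
  rw [mul_pow]
  exact mul_le_mul_of_nonneg_right (pow_le_pow_left₀ hC (hc i hi) 2) (sq_nonneg _)

/-- The operator norm is at most the Frobenius norm of an array of at most `r × r` entries bounded
by `x`. Every factor `r` in front of the skewness parameters comes from here. -/
theorem norm_famProj_mul_mul_famProj_le {u : ι → H} {v : κ → H} (hu : Orthonormal ℝ u)
    (hv : Orthonormal ℝ v) (M : H →L[ℝ] H) {I : Finset ι} {J : Finset κ} {x : ℝ} {r : ℕ}
    (hI : I.card ≤ r) (hJ : J.card ≤ r) (hx : 0 ≤ x)
    (hM : ∀ i ∈ I, ∀ j ∈ J, |inner ℝ (u i) (M (v j))| ≤ x) :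
    ‖famProj u I * M * famProj v J‖ ≤ r * x := by
  refine ContinuousLinearMap.opNorm_le_bound _ (by positivity) fun z => ?_
  refine le_of_sq_le_sq ?_ (by positivity)
  have h1 : ∀ i ∈ I, inner ℝ (u i) (M (famProj v J z)) ^ 2 ≤ r * x ^ 2 * ‖z‖ ^ 2 := by
    intro i hi
    have : inner ℝ (u i) (M (famProj v J z)) =
        ∑ j ∈ J, inner ℝ (u i) (M (v j)) * inner ℝ (v j) z := by
      simp [famProj_apply, inner_sum, inner_smul_right, mul_comm]
    rw [this]
    refine (Finset.sum_mul_sq_le_sq_mul_sq _ _ _).trans ?_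
    refine mul_le_mul ?_ (sum_inner_sq_le hv J z) (Finset.sum_nonneg fun _ _ => sq_nonneg _)
      (by positivity)
    calc _ ≤ ∑ j ∈ J, x ^ 2 := Finset.sum_le_sum fun j hj =>
          sq_le_sq' (neg_le_of_abs_le (hM i hi j hj)) (le_of_abs_le (hM i hi j hj))
      _ ≤ r * x ^ 2 := by
          rw [Finset.sum_const, nsmul_eq_mul]
          gcongr
  rw [mul_apply_eq_comp, mul_apply_eq_comp, famProj_apply, norm_sum_smul_sq hu]
  refine (Finset.sum_le_sum h1).trans ?_
  rw [Finset.sum_const, nsmul_eq_mul]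
  calc (I.card : ℝ) * (r * x ^ 2 * ‖z‖ ^ 2) ≤ r * (r * x ^ 2 * ‖z‖ ^ 2) := by gcongr
    _ = _ := by ring

/-- Dimension count behind min-max: fewer linear conditions than dimensions leave a nonzero
solution. -/
theorem exists_ne_zero_famProj_eq_self_of_card_lt {v : ι → H} (hv : Orthonormal ℝ v) (g : κ → H)
    {I : Finset ι} {J : Finset κ} (h : J.card < I.card) :
    ∃ w : H, w ≠ 0 ∧ famProj v I w = w ∧ ∀ j ∈ J, inner ℝ (g j) w = 0 := by
  classical
  have hv' : Orthonormal ℝ (fun i : I => v i) := hv.comp _ Subtype.val_injective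
  let L : (I → ℝ) →ₗ[ℝ] H := Fintype.linearCombination ℝ (fun i : I => v i)
  let f : (I → ℝ) →ₗ[ℝ] (J → ℝ) := LinearMap.pi fun j => (innerₛₗ ℝ (g j)) ∘ₗ L
  have hf : LinearMap.ker f ≠ ⊥ := LinearMap.ker_ne_bot_of_finrank_lt (by simpa using h)
  obtain ⟨c, hc, hc0⟩ := Submodule.exists_mem_ne_zero_of_ne_bot hf
  refine ⟨L c, fun h0 => hc0 ?_, ?_, fun j hj => ?_⟩
  · have := Fintype.linearIndependent_iff.mp hv'.linearIndependent c
      (by simpa [L, Fintype.linearCombination_apply] using h0)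
    exact funext this
  · rw [famProj_apply, ← Finset.sum_coe_sort I (fun i => inner ℝ (v i) (L c) • v i)]
    simp only [L, Fintype.linearCombination_apply]
    refine Finset.sum_congr rfl fun i _ => ?_
    rw [hv'.inner_right_fintype c i]
  · exact congrFun (LinearMap.mem_ker.mp hc) ⟨j, hj⟩

/-- Between spaces of equal finite dimension an injective linear map is surjective. -/
theorem exists_famProj_preimage (v : ι → H) {g : κ → H} (hg : Orthonormal ℝ g)
    {I : Finset ι} {J : Finset κ} (h : I.card = J.card)
    (hinj : ∀ q, famProj g J q = q → famProj v I q = 0 → q = 0) (z : H) :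
    ∃ q, famProj g J q = q ∧ famProj v I q = famProj v I z := by
  classical
  have hg' : Orthonormal ℝ (fun i : J => g i) := hg.comp _ Subtype.val_injective
  let L : (J → ℝ) →ₗ[ℝ] H := Fintype.linearCombination ℝ (fun i : J => g i)
  have hL : ∀ c, famProj g J (L c) = L c := by
    intro c
    rw [famProj_apply, ← Finset.sum_coe_sort J (fun i => inner ℝ (g i) (L c) • g i)]
    simp only [L, Fintype.linearCombination_apply]
    refine Finset.sum_congr rfl fun i _ => ?_
    rw [hg'.inner_right_fintype c i]
  let f : (J → ℝ) →ₗ[ℝ] (I → ℝ) := LinearMap.pi fun i => (innerₛₗ ℝ (v i)) ∘ₗ L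
  have hf : Function.Injective f := by
    rw [injective_iff_map_eq_zero]
    intro c hc
    have h0 : L c = 0 := hinj _ (hL c) (by
      rw [famProj_apply]
      refine Finset.sum_eq_zero fun i hi => ?_
      have : inner ℝ (v i) (L c) = 0 := congrFun hc ⟨i, hi⟩
      rw [this, zero_smul])
    exact funext (Fintype.linearIndependent_iff.mp hg'.linearIndependent c
      (by simpa [L, Fintype.linearCombination_apply] using h0))
  obtain ⟨c, hc⟩ := (LinearMap.injective_iff_surjective_of_finrank_eq_finrank
    (by simpa using h.symm)).mp hf (fun i : I => inner ℝ (v i) z)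
  refine ⟨L c, hL c, ?_⟩
  rw [famProj_apply, famProj_apply]
  refine Finset.sum_congr rfl fun i hi => ?_
  have : inner ℝ (v i) (L c) = inner ℝ (v i) z := congrFun hc ⟨i, hi⟩
  rw [this]

theorem norm_sq_sub_famProj {v : ι → H} (hv : Orthonormal ℝ v) (I : Finset ι)
    (z : H) : ‖z - famProj v I z‖ ^ 2 = ‖z‖ ^ 2 - ‖famProj v I z‖ ^ 2 := by
  have h : inner ℝ z (famProj v I z) = ‖famProj v I z‖ ^ 2 := by
    rw [famProj_apply, norm_sum_smul_sq hv, inner_sum]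
    refine Finset.sum_congr rfl fun i _ => ?_
    rw [inner_smul_right, real_inner_comm, sq]
  rw [norm_sub_sq_real, h]
  ring

theorem inner_famProj_left [CompleteSpace H] (v : ι → H) (I : Finset ι) (y z : H) :
    inner ℝ (famProj v I y) z = inner ℝ y (famProj v I z) := by
  rw [← ContinuousLinearMap.adjoint_inner_right, ← ContinuousLinearMap.star_eq_adjoint,
    star_famProj]

theorem norm_one_sub_famProj_le [CompleteSpace H] {v : ι → H} (hv : Orthonormal ℝ v)
    (I : Finset ι) : ‖1 - famProj v I‖ ≤ 1 :=
  (isStarProjection_famProj hv I).one_sub.norm_le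

/-- For two subspaces of the same dimension the two `sin Θ` norms agree (one inequality). -/
theorem norm_one_sub_famProj_mul_famProj_le [CompleteSpace H] {v : ι → H} {g : κ → H}
    (hv : Orthonormal ℝ v) (hg : Orthonormal ℝ g) {I : Finset ι} {J : Finset κ}
    (h : I.card = J.card) :
    ‖(1 - famProj g J) * famProj v I‖ ≤ ‖(1 - famProj v I) * famProj g J‖ := by
  set s := ‖(1 - famProj v I) * famProj g J‖ with hs
  have hs0 : 0 ≤ s := norm_nonneg _
  rcases le_or_gt 1 s with h1 | h1
  · refine le_trans ?_ h1
    refine (norm_mul_le _ _).trans ?_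
    exact mul_le_one₀ (norm_one_sub_famProj_le hg J) (norm_nonneg _) (norm_famProj_le hv I)
  have hq : ∀ q, famProj g J q = q → ‖q - famProj v I q‖ ≤ s * ‖q‖ := by
    intro q hq
    have := ((1 - famProj v I) * famProj g J).le_opNorm q
    rw [mul_apply_eq_comp, hq] at this
    simpa using this
  refine ContinuousLinearMap.opNorm_le_bound _ hs0 fun z => ?_
  have hz : ‖famProj v I z‖ ≤ ‖z‖ := by
    simpa using (famProj v I).le_of_opNorm_le (norm_famProj_le hv I) z
  refine le_trans ?_ (mul_le_mul_of_nonneg_left hz hs0)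
  -- As `s < 1`, the projection to the span of `v` is injective on the span of `g`, so `P_v z = w`
  -- has a preimage `q` there. Then `‖w‖² = ⟪P_g w, q⟫` and `(1 - s²) ‖q‖² ≤ ‖w‖²` together force
  -- `‖P_g w‖² ≥ (1 - s²) ‖w‖²`.
  obtain ⟨q, hqJ, hqz⟩ := exists_famProj_preimage v hg h (fun q hqJ hq0 => by
    have := hq q hqJ
    rw [hq0, sub_zero] at this
    by_contra hne
    have := norm_pos_iff.mpr hne
    nlinarith) z
  set w := famProj v I z with hw
  have hw' : famProj v I w = w := by
    rw [hw, ← mul_apply_eq_comp, (isStarProjection_famProj hv I).isIdempotentElem.eq]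
  have e1 : ‖w‖ ^ 2 = inner ℝ (famProj g J w) q := by
    rw [inner_famProj_left, hqJ, ← hw', inner_famProj_left, hqz, hw', real_inner_self_eq_norm_sq]
  have e2 : ‖w‖ ^ 2 ≤ ‖famProj g J w‖ * ‖q‖ := e1.trans_le (real_inner_le_norm _ _)
  have e3 : ‖q‖ ^ 2 - ‖w‖ ^ 2 ≤ s ^ 2 * ‖q‖ ^ 2 := by
    rw [← hqz, ← norm_sq_sub_famProj hv, ← mul_pow]
    exact pow_le_pow_left₀ (norm_nonneg _) (hq q hqJ) 2
  refine le_of_sq_le_sq ?_ (by positivity)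
  rw [mul_apply_eq_comp, ← hw, sub_apply, one_apply_eq_self,
    norm_sq_sub_famProj hg, mul_pow]
  rcases (norm_nonneg w).eq_or_lt with h0 | h0
  · rw [← h0]
    nlinarith [sq_nonneg ‖famProj g J w‖]
  have e4 : (‖w‖ ^ 2) ^ 2 ≤ ‖famProj g J w‖ ^ 2 * ‖q‖ ^ 2 := by
    rw [← mul_pow]
    exact pow_le_pow_left₀ (sq_nonneg _) e2 2
  have e5 : ‖q‖ ^ 2 * (1 - s ^ 2) ≤ ‖w‖ ^ 2 := by linarith
  have hs1 : 0 < 1 - s ^ 2 := by nlinarith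
  have e6 : ‖w‖ ^ 2 * (‖w‖ ^ 2 * (1 - s ^ 2)) ≤ ‖w‖ ^ 2 * ‖famProj g J w‖ ^ 2 := by
    have := mul_le_mul_of_nonneg_left e5 (sq_nonneg ‖famProj g J w‖)
    have := mul_le_mul_of_nonneg_right e4 hs1.le
    nlinarith
  have := le_of_mul_le_mul_left e6 (by positivity)
  linarith

end SvdSum

/-! ### Algebraic identities and norm estimates for singular subspaces. -/

section CStar

variable {R : Type*} [NormedRing R]

theorem norm_mul_le_of_le' {a b : R} {α β : ℝ} (ha : ‖a‖ ≤ α) (hb : ‖b‖ ≤ β) :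
    ‖a * b‖ ≤ α * β :=
  (norm_mul_le a b).trans (mul_le_mul ha hb (norm_nonneg _) ((norm_nonneg _).trans ha))

variable [StarRing R] [CStarRing R]

/-- One half of the coupled estimates for the components `nl * ql`, `nr * qr` of the perturbed
singular subspaces. Here `b` is the pseudoinverse of the leading part of `a + e`. -/
theorem norm_rest_mul_le {a e b pl nl kl nr rr kr ql qr : R} {s X Y ε β : ℝ}
    (hsum : pl + nl + kl = 1) (hsumr : rr + kr = 1)
    (hnl : ‖nl‖ ≤ 1) (hkl : ‖kl‖ ≤ 1) (hkr : ‖kr‖ ≤ 1)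
    (hspl : star pl = pl) (hsrr : star rr = rr) (hrr : rr * rr = rr)
    (hskr : star kr = kr) (hsqr : star qr = qr)
    (hnla : nl * a = nl * a * nr) (hkla : kl * a = 0) (hakr : a * kr = 0)
    (hql : (a + e) * b = ql) (hqr : b * (a + e) = qr) (hbl : b * ql = b) (hbr : qr * b = b)
    (hsql : star ql = ql)
    (hs : ‖nl * a‖ ≤ s) (hXn : ‖nl * e * rr‖ ≤ X) (hXp : ‖pl * e * rr‖ ≤ X)
    (hY : ‖nl * e * star e * pl‖ ≤ Y) (hε : ‖e‖ ≤ ε) (hβ : ‖b‖ ≤ β) :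
    ‖nl * ql‖ ≤ β * (s * ‖nr * qr‖ + X + β * (Y + X ^ 2 + ε ^ 2 * ‖nl * ql‖ + ε ^ 3 * β)) := by
  have hε0 : 0 ≤ ε := (norm_nonneg _).trans hε
  have hβ0 : 0 ≤ β := (norm_nonneg _).trans hβ
  have hX0 : 0 ≤ X := (norm_nonneg _).trans hXn
  have hse : ‖star e‖ ≤ ε := by rwa [norm_star]
  have hsb : ‖star b‖ ≤ β := by rwa [norm_star]
  have hklql : kl * ql = kl * e * b := by
    rw [← hql, add_mul, mul_add, ← mul_assoc, hkla, zero_mul, zero_add, mul_assoc]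
  -- Since `kr` annihilates `star a`, rewriting `b = qr * b` with `qr = star (a + e) * star b`
  -- leaves only the contribution of `e`.
  have hkrb : kr * b = kr * star e * star b * b := by
    have h1 : qr = star a * star b + star e * star b := by
      rw [← hsqr, ← hqr, star_mul, star_add, add_mul]
    have h2 : kr * star a = 0 := by rw [← hskr, ← star_mul, hakr, star_zero]
    calc kr * b = kr * (qr * b) := by rw [hbr]
      _ = (kr * star a) * star b * b + kr * star e * star b * b := by rw [h1]; noncomm_ring
      _ = _ := by rw [h2]; noncomm_ring
  have hsb' : star b = ql * star b := by
    conv_lhs => rw [← hbl, star_mul, hsql]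
  -- Expand `ql` into its three blocks. In the `pl` block `kr = 1 - rr` yields the `Y` and `X ^ 2`
  -- terms; the `nl` block returns the unknown with the small factor `ε ^ 2`; the `kl` block gains
  -- one more `e`.
  have hW : nl * e * kr * star e * star b =
      nl * e * star e * pl * star b - (nl * e * rr) * (rr * star e * pl) * star b
        + nl * e * kr * star e * (nl * ql) * star b
        + nl * e * kr * star e * (kl * e * b) * star b := by
    have hkr' : kr = 1 - rr := by rw [← hsumr]; abel
    have h3 : nl * e * kr * star e * pl =
        nl * e * star e * pl - (nl * e * rr) * (rr * star e * pl) := by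
      have : (nl * e * rr) * (rr * star e * pl) = nl * e * (rr * rr) * star e * pl := by
        noncomm_ring
      rw [this, hrr, hkr']
      noncomm_ring
    have hdec : ql = pl * ql + nl * ql + kl * e * b := by
      rw [← hklql, ← add_mul, ← add_mul, hsum, one_mul]
    calc nl * e * kr * star e * star b
        = nl * e * kr * star e * (ql * star b) := by rw [← hsb']
      _ = nl * e * kr * star e * ((pl * ql + nl * ql + kl * e * b) * star b) := by
          rw [← hdec]
      _ = (nl * e * kr * star e * pl) * (ql * star b) + nl * e * kr * star e * (nl * ql) * star b
        + nl * e * kr * star e * (kl * e * b) * star b := by noncomm_ring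
      _ = _ := by rw [h3, ← hsb']; noncomm_ring
  have hXp' : ‖rr * star e * pl‖ ≤ X := by
    have : star (pl * e * rr) = rr * star e * pl := by
      rw [star_mul, star_mul, hspl, hsrr, mul_assoc]
    rwa [← this, norm_star]
  have hne : ‖nl * e * kr * star e‖ ≤ ε ^ 2 := by
    refine (norm_mul_le_of_le' (norm_mul_le_of_le' (norm_mul_le_of_le' hnl hε) hkr) hse).trans ?_
    exact le_of_eq (by ring)
  have hWn : ‖nl * e * kr * star e * star b‖ ≤
      β * (Y + X ^ 2 + ε ^ 2 * ‖nl * ql‖ + ε ^ 3 * β) := by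
    rw [hW]
    refine (norm_add_le _ _).trans ?_
    refine (add_le_add_left (norm_add_le _ _) _).trans ?_
    refine (add_le_add_left (add_le_add_left (norm_sub_le _ _) _) _).trans ?_
    have n1 := norm_mul_le_of_le' hY hsb
    have n2 := norm_mul_le_of_le' (norm_mul_le_of_le' hXn hXp') hsb
    have n3 := norm_mul_le_of_le' (norm_mul_le_of_le' hne (le_refl ‖nl * ql‖)) hsb
    have n4 := norm_mul_le_of_le' (norm_mul_le_of_le' hne
      (norm_mul_le_of_le' (norm_mul_le_of_le' hkl hε) hβ)) hsb
    refine (add_le_add (add_le_add (add_le_add n1 n2) n3) n4).trans (le_of_eq (by ring))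
  have hmain : nl * ql = (nl * a * (nr * qr) + nl * e * rr
      + nl * e * kr * star e * star b) * b := by
    calc nl * ql = (nl * a) * b + nl * e * (rr + kr) * b := by
          rw [← hql, hsumr]; noncomm_ring
      _ = (nl * a * nr) * (qr * b) + nl * e * rr * b + nl * e * (kr * b) := by
          rw [← hnla, hbr]; noncomm_ring
      _ = _ := by rw [hkrb]; noncomm_ring
  conv_lhs => rw [hmain]
  refine (norm_mul_le_of_le' ?_ hβ).trans (le_of_eq (mul_comm _ _))
  refine (norm_add_le _ _).trans (add_le_add ?_ hWn)
  exact (norm_add_le _ _).trans (add_le_add (norm_mul_le_of_le' hs le_rfl) hXn)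

/-- Idempotence lets each subspace error be paired with a discarded part: `(1 - qr) * pr` with `(a +
e) * (1 - qr)`, and `ql * nl` with `nl * a`. The two other terms each contain one bare `e`. -/
theorem norm_sub_leading_le {a e pl nl kl pr ql qr : R} {s m k τ ε : ℝ}
    (hpl : pl + nl + kl = 1) (hap : a * pr = pl * a)
    (hql : ‖ql‖ ≤ 1) (hpr : ‖pr‖ ≤ 1) (hpr' : ‖1 - pr‖ ≤ 1)
    (hsnl : star nl = nl) (hnl : nl * nl = nl) (hsql : star ql = ql) (hqr : qr * qr = qr)
    (hkla : kl * a = 0) (hq : (a + e) * qr = ql * (a + e))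
    (hs : ‖nl * a‖ ≤ s) (hm : ‖nl * ql‖ ≤ m) (hk : ‖(1 - qr) * pr‖ ≤ k)
    (hτ : ‖(a + e) * (1 - qr)‖ ≤ τ) (hε : ‖e‖ ≤ ε) :
    ‖(a + e) * qr - a * pr‖ ≤ 2 * ε + τ * k + m * s := by
  have h1 : a * (1 - pr) = nl * nl * a := by
    have : nl = 1 - pl - kl := by rw [← hpl]; abel
    rw [hnl, this, mul_sub, hap, sub_mul, sub_mul, hkla]
    simp
  have hqq : (1 - qr) * (1 - qr) = 1 - qr := by
    have : (1 - qr) * (1 - qr) = 1 - qr - qr + qr * qr := by noncomm_ring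
    rw [this, hqr]
    abel
  have hD : (a + e) * qr - a * pr = e * pr - (a + e) * (1 - qr) * ((1 - qr) * pr)
      + ql * e * (1 - pr) + (ql * nl) * (nl * a) := by
    calc (a + e) * qr - a * pr = e * pr - (a + e) * (1 - qr) * pr + (a + e) * qr * (1 - pr) := by
          noncomm_ring
      _ = e * pr - (a + e) * ((1 - qr) * (1 - qr)) * pr + ql * e * (1 - pr)
          + ql * (a * (1 - pr)) := by rw [hq, hqq]; noncomm_ring
      _ = _ := by rw [h1]; noncomm_ring
  have hm' : ‖ql * nl‖ ≤ m := by
    rwa [← norm_star, star_mul, hsnl, hsql]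
  rw [hD]
  refine (norm_add_le _ _).trans ?_
  refine (add_le_add_left (norm_add_le _ _) _).trans ?_
  refine (add_le_add_left (add_le_add_left (norm_sub_le _ _) _) _).trans ?_
  have n1 := norm_mul_le_of_le' hε hpr
  have n2 := norm_mul_le_of_le' hτ hk
  have n3 := norm_mul_le_of_le' (norm_mul_le_of_le' hql hε) hpr'
  have n4 := norm_mul_le_of_le' hm' hs
  linarith

end CStar

/-- The scalar part of the argument: `m` bounds the components of the perturbed singular subspaces
along the remaining singular vectors. -/
theorem leading_error_bound {σ δ ε X Y m : ℝ} (hδ : 0 < δ) (hδσ : δ ≤ σ) (hε : 0 ≤ ε) (hX : 0 ≤ X)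
    (hY : 0 ≤ Y) (hm : 0 ≤ m) (hXδ : X ≤ δ / 24) (hεσ : ε ≤ σ / 24)
    (hεδ : ε ^ 2 ≤ σ * δ / 576)
    (h : m ≤ (σ - X)⁻¹ * ((σ - δ) * m + X
      + (σ - X)⁻¹ * (Y + X ^ 2 + ε ^ 2 * m + ε ^ 3 * (σ - X)⁻¹))) :
    2 * ε + (σ - δ + ε) * (m + ε * (σ - X)⁻¹) + m * (σ - δ)
      ≤ 8 * (ε + σ * X / δ + Y / δ) := by
  have hσ : 0 < σ := hδ.trans_le hδσ
  have hg : 23 / 24 * σ ≤ σ - X := by linarith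
  have hg0 : 0 < σ - X := by linarith
  have hβ : (σ - X)⁻¹ ≤ 24 / 23 * σ⁻¹ := by
    rw [← inv_div, ← mul_inv]
    exact inv_anti₀ (by positivity) hg
  have hβ0 : 0 < (σ - X)⁻¹ := inv_pos.mpr hg0
  set β := (σ - X)⁻¹ with hβdef
  have hβσ : β * σ ≤ 24 / 23 := by
    calc β * σ ≤ 24 / 23 * σ⁻¹ * σ := by gcongr
      _ = 24 / 23 := by field_simp
  have hgm : (σ - X) * m ≤ (σ - δ) * m + X + β * (Y + X ^ 2 + ε ^ 2 * m + ε ^ 3 * β) := by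
    have := mul_le_mul_of_nonneg_left h hg0.le
    rwa [← mul_assoc, hβdef, mul_inv_cancel₀ hg0.ne', one_mul] at this
  have b1 : β * ε ^ 2 ≤ δ / 552 := by
    calc β * ε ^ 2 ≤ β * (σ * δ / 576) := by gcongr
      _ = (β * σ) * (δ / 576) := by ring
      _ ≤ 24 / 23 * (δ / 576) := by gcongr
      _ = δ / 552 := by ring
  have b2 : β * ε ≤ 1 / 23 := by
    calc β * ε ≤ β * (σ / 24) := by gcongr
      _ = (β * σ) / 24 := by ring
      _ ≤ 24 / 23 / 24 := by gcongr
      _ = 1 / 23 := by norm_num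
  have b3 : β * X ≤ 1 / 23 := by
    calc β * X ≤ β * (σ / 24) := by gcongr; linarith
      _ = (β * σ) / 24 := by ring
      _ ≤ 24 / 23 / 24 := by gcongr
      _ = 1 / 23 := by norm_num
  -- Moving the `m` terms to the left leaves the coefficient `δ (1 - 1/24 - 1/552) = (22/23) δ`,
  -- which exceeds `(23/25) δ`.
  have hδm : 23 / 25 * δ * m ≤ 24 / 23 * X + β * Y + δ / 552 * (ε * β) := by
    have c1 : β * ε ^ 2 * m ≤ δ / 552 * m := by gcongr
    have c2 : β * X * X ≤ 1 / 23 * X := by gcongr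
    have c3 : β * ε ^ 2 * (ε * β) ≤ δ / 552 * (ε * β) := by gcongr
    have c4 : X * m ≤ δ / 24 * m := by gcongr
    have c5 : 0 ≤ δ * m := by positivity
    linarith
  -- Multiply by `σ / δ`; the `ε` coefficient is `(24/23) / 552 = 1/529`.
  have hσm : 23 / 25 * (σ * m) ≤ 24 / 23 * (σ * X / δ + Y / δ) + 1 / 529 * ε := by
    have h1 := mul_le_mul_of_nonneg_left hδm (by positivity : 0 ≤ σ / δ)
    have e1 : σ / δ * (23 / 25 * δ * m) = 23 / 25 * (σ * m) := by field_simp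
    have e2 : σ / δ * (24 / 23 * X + β * Y + δ / 552 * (ε * β)) =
        24 / 23 * (σ * X / δ) + (β * σ) * (Y / δ) + (β * σ) * (ε / 552) := by field_simp
    rw [e1, e2] at h1
    have d1 : (β * σ) * (Y / δ) ≤ 24 / 23 * (Y / δ) := by gcongr
    have d2 : (β * σ) * (ε / 552) ≤ 24 / 23 * (ε / 552) := by gcongr
    linarith
  have hA : 0 ≤ σ * X / δ := by positivity
  have hB : 0 ≤ Y / δ := by positivity
  have f1 : ε * m ≤ σ / 24 * m := by gcongr
  have f2 : (β * σ) * ε ≤ 24 / 23 * ε := by gcongr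
  have f3 : β * ε * ε ≤ 1 / 23 * ε := by gcongr
  have f4 : 0 ≤ δ * m := by positivity
  have f5 : 0 ≤ δ * (ε * β) := by positivity
  linarith

/-! ### Singular value comparison and the perturbation bound for operators. -/

section Perturbation

variable {H ι : Type*} [NormedAddCommGroup H] [InnerProductSpace ℝ H]

theorem svdSum_congr (u v : ι → H) {c d : ι → ℝ} {I : Finset ι} (h : ∀ i ∈ I, c i = d i) :
    svdSum u v c I = svdSum u v d I :=
  Finset.sum_congr rfl fun i hi => by rw [h i hi]

theorem famProj_add_famProj_compl [Fintype ι] [DecidableEq ι] (u : ι → H) (I : Finset ι) :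
    famProj u I + famProj u Iᶜ = famProj u Finset.univ :=
  Finset.sum_add_sum_compl I _

/-- The first `p` indices in `Fin r`. -/
def head (r p : ℕ) : Finset (Fin r) := Finset.univ.filter fun i => (i : ℕ) < p

theorem mem_head {r p : ℕ} {i : Fin r} : i ∈ head r p ↔ (i : ℕ) < p := by simp [head]

theorem card_head (r p : ℕ) : (head r p).card = min r p := by
  simp [head, Fin.card_filter_val_lt]

theorem card_le_of_fin {r : ℕ} (I : Finset (Fin r)) : I.card ≤ r := by
  simpa using I.card_le_univ

theorem norm_svdSum_apply_le_of_inner_eq_zero [Fintype ι] {u v : ι → H}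
    (hu : Orthonormal ℝ u) (hv : Orthonormal ℝ v) {c : ι → ℝ} {J : Finset ι} {C : ℝ} (hC : 0 ≤ C)
    (hc : ∀ i ∉ J, |c i| ≤ C) {w : H} (hw : ∀ j ∈ J, inner ℝ (v j) w = 0) :
    ‖svdSum u v c Finset.univ w‖ ≤ C * ‖w‖ := by
  classical
  have h : svdSum u v c Finset.univ w = svdSum u v c Jᶜ w := by
    rw [svdSum_apply, svdSum_apply, ← Finset.sum_add_sum_compl J, add_eq_right]
    exact Finset.sum_eq_zero fun i hi => by rw [hw i hi, mul_zero, zero_smul]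
  rw [h]
  exact ContinuousLinearMap.le_of_opNorm_le _
    (norm_svdSum_le hu hv hC fun i hi => hc i (Finset.mem_compl.mp hi)) w

/-- Weyl's inequality for the first discarded singular value. -/
theorem singularValue_succ_le {r b p : ℕ} {u v : Fin r → H} {u' v' : Fin b → H} {σ t : ℕ → ℝ}
    (hu : Orthonormal ℝ u) (hv : Orthonormal ℝ v)
    (hu' : Orthonormal ℝ u') (hv' : Orthonormal ℝ v')
    (hσ : Antitone σ) (hσ0 : ∀ i, 0 ≤ σ i) (ht : Antitone t) (ht0 : ∀ i, 0 ≤ t i) (hpb : p < b)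
    {A E : H →L[ℝ] H} (hA : A = svdSum u v (fun i => σ i) Finset.univ)
    (hAE : A + E = svdSum u' v' (fun i => t i) Finset.univ) :
    t p ≤ σ p + ‖E‖ := by
  -- Indices start at `0`, so `t p` is the `(p + 1)`-st singular value: `p + 1` dimensions against
  -- at most `p` conditions.
  obtain ⟨w, hw0, hw, hwv⟩ := exists_ne_zero_famProj_eq_self_of_card_lt hv' v
    (I := head b (p + 1)) (J := head r p) (by rw [card_head, card_head]; omega)
  have h1 : t p * ‖w‖ ≤ ‖(A + E) w‖ := by
    rw [hAE]
    refine mul_norm_le_norm_svdSum hu' hv' (ht0 p) (fun i hi => ht ?_) hw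
    have := mem_head.mp hi
    omega
  have h2 : ‖A w‖ ≤ σ p * ‖w‖ := by
    rw [hA]
    refine norm_svdSum_apply_le_of_inner_eq_zero hu hv (hσ0 p) (fun i hi => ?_) hwv
    rw [abs_of_nonneg (hσ0 _)]
    exact hσ (by simpa [mem_head] using hi)
  have h3 : ‖(A + E) w‖ ≤ (σ p + ‖E‖) * ‖w‖ := by
    rw [add_mul]
    exact (norm_add_le _ _).trans (add_le_add h2 (E.le_opNorm w))
  exact le_of_mul_le_mul_right (h1.trans h3) (norm_pos_iff.mpr hw0)

/-- The `(q + 1)`-st singular value decreases at most by the norm of the compression of the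
perturbation to the leading singular subspaces. -/
theorem sub_le_singularValue {r b q : ℕ} {u v : Fin r → H} {u' v' : Fin b → H} {σ t : ℕ → ℝ}
    (hu : Orthonormal ℝ u) (hv : Orthonormal ℝ v)
    (hu' : Orthonormal ℝ u') (hv' : Orthonormal ℝ v')
    (hσ : Antitone σ) (hσ0 : ∀ i, 0 ≤ σ i) (ht : Antitone t) (ht0 : ∀ i, 0 ≤ t i) (hqr : q < r)
    {A E : H →L[ℝ] H} (hA : A = svdSum u v (fun i => σ i) Finset.univ)
    (hAE : A + E = svdSum u' v' (fun i => t i) Finset.univ) {X : ℝ}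
    (hX : ‖famProj u Finset.univ * E * famProj v Finset.univ‖ ≤ X) :
    σ q - X ≤ t q := by
  obtain ⟨w, hw0, hw, hwv⟩ := exists_ne_zero_famProj_eq_self_of_card_lt hv v'
    (I := head r (q + 1)) (J := head b q) (by rw [card_head, card_head]; omega)
  have h1 : σ q * ‖w‖ ≤ ‖A w‖ := by
    rw [hA]
    refine mul_norm_le_norm_svdSum hu hv (hσ0 q) (fun i hi => hσ ?_) hw
    have := mem_head.mp hi
    omega
  have h2 : ‖(A + E) w‖ ≤ t q * ‖w‖ := by
    rw [hAE]
    refine norm_svdSum_apply_le_of_inner_eq_zero hu' hv' (ht0 q) (fun i hi => ?_) hwv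
    rw [abs_of_nonneg (ht0 _)]
    exact ht (by simpa [mem_head] using hi)
  have hw' : famProj v Finset.univ w = w := by
    rw [← hw, ← mul_apply_eq_comp, famProj_mul_famProj hv, Finset.univ_inter]
  -- Projecting to the column space fixes `A w`. As `w` lies in the row space, `E` enters only
  -- through its compression, hence the loss `X` instead of `‖E‖`.
  have hAw : famProj u Finset.univ ((A + E) w) =
      A w + (famProj u Finset.univ * E * famProj v Finset.univ) w := by
    rw [mul_apply_eq_comp, mul_apply_eq_comp, hw', add_apply, map_add]
    congr 1
    rw [hA, ← mul_apply_eq_comp, famProj_mul_svdSum v hu, Finset.univ_inter]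
  have h3 : ‖famProj u Finset.univ ((A + E) w)‖ ≤ ‖(A + E) w‖ := by
    simpa using (famProj u Finset.univ).le_of_opNorm_le (norm_famProj_le hu _) ((A + E) w)
  have h4 := ContinuousLinearMap.le_of_opNorm_le _ hX w
  have h5 : ‖A w‖ - ‖(famProj u Finset.univ * E * famProj v Finset.univ) w‖ ≤
      ‖famProj u Finset.univ ((A + E) w)‖ := by
    rw [hAw]
    exact norm_sub_le_norm_add _ _
  refine le_of_mul_le_mul_right ?_ (norm_pos_iff.mpr hw0)
  rw [sub_mul]
  linarith

/-- Perturbation of the best rank `p` approximation, for operators on a Hilbert space. -/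
theorem norm_svdSum_head_sub_le [CompleteSpace H] {r b p : ℕ} {u v : Fin r → H}
    {u' v' : Fin b → H} {σ t : ℕ → ℝ}
    (hu : Orthonormal ℝ u) (hv : Orthonormal ℝ v)
    (hu' : Orthonormal ℝ u') (hv' : Orthonormal ℝ v')
    (hσ : Antitone σ) (hσ0 : ∀ i, 0 ≤ σ i) (ht : Antitone t) (ht0 : ∀ i, 0 ≤ t i)
    (htb : ∀ i, 0 < t i → i < b) (hp : 1 ≤ p) (hpr : p ≤ r)
    {A E : H →L[ℝ] H} (hA : A = svdSum u v (fun i => σ i) Finset.univ)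
    (hAE : A + E = svdSum u' v' (fun i => t i) Finset.univ) {x y : ℝ}
    (hx0 : 0 ≤ x) (hy0 : 0 ≤ y)
    (hx : ∀ i j, |inner ℝ (u i) (E (v j))| ≤ x)
    (hyu : ∀ i j, i ≠ j → |inner ℝ (u i) ((E * star E) (u j))| ≤ y)
    (hyv : ∀ i j, i ≠ j → |inner ℝ (v i) ((star E * E) (v j))| ≤ y)
    (hδ : 0 < σ (p - 1) - σ p) (hxδ : r * x ≤ (σ (p - 1) - σ p) / 24)
    (hε : ‖E‖ ≤ σ (p - 1) / 24) (hε2 : ‖E‖ ^ 2 ≤ σ (p - 1) * (σ (p - 1) - σ p) / 576) :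
    ‖svdSum u' v' (fun i => t i) (head b p) - svdSum u v (fun i => σ i) (head r p)‖ ≤
      8 * (‖E‖ + σ (p - 1) * (r * x) / (σ (p - 1) - σ p) + r * y / (σ (p - 1) - σ p)) := by
  set I := head r p with hI
  set J := head b p with hJ
  set rl := famProj u Finset.univ with hrl
  set rr := famProj v Finset.univ with hrr
  have hXR : ‖rl * E * rr‖ ≤ r * x :=
    norm_famProj_mul_mul_famProj_le hu hv E (card_le_of_fin _) (card_le_of_fin _) hx0
      fun i _ j _ => hx i j
  have hX0 : 0 ≤ r * x := by positivity
  have hY0 : 0 ≤ r * y := by positivity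
  have hg : 0 < σ (p - 1) - r * x := by linarith [hσ0 p]
  have htp : σ (p - 1) - r * x ≤ t (p - 1) :=
    sub_le_singularValue hu hv hu' hv' hσ hσ0 ht ht0 (by omega) hA hAE hXR
  -- Positivity of `t (p - 1)` shows that the perturbed decomposition has at least `p` terms. Both
  -- leading families therefore have exactly `p` members, as the comparison of `sin Θ` norms
  -- requires.
  have hpb : p ≤ b := by
    have := htb (p - 1) (hg.trans_le htp)
    omega
  set β := (σ (p - 1) - r * x)⁻¹ with hβ
  have hβ0 : 0 ≤ β := inv_nonneg.mpr hg.le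
  have htJ : ∀ i ∈ J, σ (p - 1) - r * x ≤ t i := fun i hi =>
    htp.trans (ht (by have := mem_head.mp hi; omega))
  set B := svdSum v' u' (fun i => (t i)⁻¹) J with hB
  set pl := famProj u I with hpl
  set pr := famProj v I with hpr'
  set nl := famProj u Iᶜ with hnl
  set nr := famProj v Iᶜ with hnr
  set ql := famProj u' J with hql
  set qr := famProj v' J with hqr
  have hsuml : pl + nl + (1 - rl) = 1 := by rw [hpl, hnl, famProj_add_famProj_compl]; abel
  have hsumr : pr + nr + (1 - rr) = 1 := by rw [hpr', hnr, famProj_add_famProj_compl]; abel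
  have hkla : (1 - rl) * A = 0 := by
    rw [sub_mul, one_mul, hA, hrl, famProj_mul_svdSum v hu, Finset.univ_inter, sub_self]
  have hakr : A * (1 - rr) = 0 := by
    rw [mul_sub, mul_one, hA, hrr, svdSum_mul_famProj u hv, Finset.univ_inter, sub_self]
  have hnla' : nl * A = svdSum u v (fun i => σ i) Iᶜ := by
    rw [hA, hnl, famProj_mul_svdSum v hu, Finset.inter_univ]
  have hanr' : A * nr = svdSum u v (fun i => σ i) Iᶜ := by
    rw [hA, hnr, svdSum_mul_famProj u hv, Finset.univ_inter]
  have hnla : nl * A = nl * A * nr := by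
    rw [hnla', hnr, svdSum_mul_famProj u hv, Finset.inter_self]
  have hanr : A * nr = nl * A * nr := by rw [← hnla, hnla', hanr']
  have hnorm : ‖svdSum u v (fun i : Fin r => σ i) Iᶜ‖ ≤ σ p := by
    refine norm_svdSum_le hu hv (hσ0 p) fun i hi => ?_
    rw [abs_of_nonneg (hσ0 _)]
    exact hσ (by simpa [hI, mem_head] using hi)
  have hTB : (A + E) * B = ql := by
    rw [hAE, hB, svdSum_mul_svdSum u' u' hv', Finset.univ_inter, hql, famProj]
    exact svdSum_congr _ _ fun i hi => mul_inv_cancel₀ (hg.trans_le (htJ i hi)).ne'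
  have hBT : B * (A + E) = qr := by
    rw [hAE, hB, svdSum_mul_svdSum v' v' hu', Finset.inter_univ, hqr, famProj]
    exact svdSum_congr _ _ fun i hi => inv_mul_cancel₀ (hg.trans_le (htJ i hi)).ne'
  have hBql : B * ql = B := by
    rw [hB, hql, svdSum_mul_famProj v' hu', Finset.inter_self]
  have hqrB : qr * B = B := by
    rw [hB, hqr, famProj_mul_svdSum u' hv', Finset.inter_self]
  have hBn : ‖B‖ ≤ β := by
    refine norm_svdSum_le hv' hu' hβ0 fun i hi => ?_
    rw [abs_of_nonneg (inv_nonneg.mpr (ht0 _))]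
    exact inv_anti₀ hg (htJ i hi)
  have hXn (K : Finset (Fin r)) : ‖famProj u K * E * rr‖ ≤ r * x :=
    norm_famProj_mul_mul_famProj_le hu hv E (card_le_of_fin _) (card_le_of_fin _) hx0
      fun i _ j _ => hx i j
  have hXn' (K : Finset (Fin r)) : ‖famProj v K * star E * rl‖ ≤ r * x := by
    refine norm_famProj_mul_mul_famProj_le hv hu (star E) (card_le_of_fin _) (card_le_of_fin _) hx0
      fun i _ j _ => ?_
    rw [ContinuousLinearMap.star_eq_adjoint, ContinuousLinearMap.adjoint_inner_right,
      real_inner_comm]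
    exact hx j i
  -- Leading and remaining indices never coincide, so only off-diagonal entries of `E * star E` and
  -- `star E * E` are needed.
  have hne : ∀ i ∈ Iᶜ, ∀ j ∈ I, i ≠ j := by
    rintro i hi j hj rfl
    exact Finset.mem_compl.mp hi hj
  have hYl : ‖nl * E * star E * pl‖ ≤ r * y := by
    rw [mul_assoc nl]
    exact norm_famProj_mul_mul_famProj_le hu hu (E * star E) (card_le_of_fin _) (card_le_of_fin _)
      hy0 fun i hi j hj => hyu i j (hne i hi j hj)
  have hYr : ‖nr * star E * star (star E) * pr‖ ≤ r * y := by
    rw [mul_assoc nr, star_star]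
    exact norm_famProj_mul_mul_famProj_le hv hv (star E * E) (card_le_of_fin _) (card_le_of_fin _)
      hy0 fun i hi j hj => hyv i j (hne i hi j hj)
  have hstar (M : H →L[ℝ] H) : ‖star M‖ = ‖M‖ := norm_star M
  have srl : star rl = rl := star_famProj _ _
  have srr : star rr = rr := star_famProj _ _
  have irl : rl * rl = rl := (isStarProjection_famProj hu _).isIdempotentElem.eq
  have irr : rr * rr = rr := (isStarProjection_famProj hv _).isIdempotentElem.eq
  have skl : star (1 - rl) = 1 - rl := by rw [star_sub, star_one, srl]
  have skr : star (1 - rr) = 1 - rr := by rw [star_sub, star_one, srr]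
  have snl : star nl = nl := star_famProj _ _
  have snr : star nr = nr := star_famProj _ _
  have sql : star ql = ql := star_famProj _ _
  have sqr : star qr = qr := star_famProj _ _
  have hnkl : ‖1 - rl‖ ≤ 1 := norm_one_sub_famProj_le hu _
  have hnkr : ‖1 - rr‖ ≤ 1 := norm_one_sub_famProj_le hv _
  have hml := norm_rest_mul_le (s := σ p) hsuml (add_sub_cancel rr 1) (norm_famProj_le hu _) hnkl hnkr
    (star_famProj _ _) srr irr skr sqr hnla hkla hakr hTB hBT hBql hqrB sql
    (by rw [hnla']; exact hnorm) (hXn _) (hXn _) hYl le_rfl hBn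
  -- The same estimate for the adjoints exchanges left and right.
  have hmr := norm_rest_mul_le (a := star A) (e := star E) (b := star B) (nr := nl) (ql := qr)
    (qr := ql) (kr := 1 - rl) (s := σ p) (ε := ‖E‖) hsumr (add_sub_cancel rl 1)
    (norm_famProj_le hv _) hnkr hnkl
    (star_famProj _ _) srl irl skl sql
    (by
      have := congrArg star hanr
      rwa [star_mul, star_mul, star_mul, snr, snl, ← mul_assoc] at this)
    (by rw [← skr, ← star_mul, hakr, star_zero])
    (by rw [← skl, ← star_mul, hkla, star_zero])
    (by rw [← star_add, ← star_mul, hBT, sqr])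
    (by rw [← star_add, ← star_mul, hTB, sql])
    (by conv_lhs => rw [← sqr, ← star_mul, hqrB])
    (by conv_lhs => rw [← sql, ← star_mul, hBql])
    sqr
    (by rw [← snr, ← star_mul, hstar, hanr']; exact hnorm) (hXn' _) (hXn' _) hYr
    (hstar E).le ((hstar B).trans_le hBn)
  -- Each estimate bounds one side by the other; the maximum closes the system.
  set m := max ‖nl * ql‖ ‖nr * qr‖ with hm
  have hm0 : 0 ≤ m := (norm_nonneg _).trans (le_max_left _ _)
  have hm1 : ‖nl * ql‖ ≤ m := le_max_left _ _
  have hm2 : ‖nr * qr‖ ≤ m := le_max_right _ _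
  have hmle : m ≤ β * ((σ (p - 1) - (σ (p - 1) - σ p)) * m + r * x
      + β * (r * y + (r * x) ^ 2 + ‖E‖ ^ 2 * m + ‖E‖ ^ 3 * β)) := by
    rw [sub_sub_cancel]
    have hσp := hσ0 p
    refine max_le (hml.trans ?_) (hmr.trans ?_) <;> gcongr
  have hscal := leading_error_bound hδ (by linarith [hσ0 p]) (norm_nonneg E) hX0 hY0 hm0 hxδ hε
    hε2 hmle
  rw [sub_sub_cancel] at hscal
  refine le_trans ?_ hscal
  have hTq : (A + E) * qr = svdSum u' v' (fun i => t i) J := by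
    rw [hAE, hqr, svdSum_mul_famProj u' hv', Finset.univ_inter]
  have hqT : ql * (A + E) = svdSum u' v' (fun i => t i) J := by
    rw [hAE, hql, famProj_mul_svdSum v' hu', Finset.inter_univ]
  have hAp : A * pr = svdSum u v (fun i => σ i) I := by
    rw [hA, hpr', svdSum_mul_famProj u hv, Finset.univ_inter]
  have hpA : pl * A = svdSum u v (fun i => σ i) I := by
    rw [hA, hpl, famProj_mul_svdSum v hu, Finset.inter_univ]
  rw [← hTq, ← hAp]
  -- The estimates control `(1 - pr) * qr`, split into its `nr` part and its kernel part; the `sin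
  -- Θ` comparison passes to `(1 - qr) * pr`.
  have hk : ‖(1 - qr) * pr‖ ≤ m + ‖E‖ * β := by
    refine (norm_one_sub_famProj_mul_famProj_le hv hv' (by
      rw [hI, hJ, card_head, card_head]; omega)).trans ?_
    have h1 : (1 - famProj v I) * famProj v' J = nr * qr + (1 - rr) * (star E * star B) := by
      have h2 : (1 - rr) * qr = (1 - rr) * (star E * star B) := by
        have h3 : qr = star A * star B + star E * star B := by
          rw [← sqr, ← hBT, star_mul, star_add, add_mul]
        rw [h3, mul_add, ← mul_assoc (1 - rr) (star A), ← skr, ← star_mul A, hakr, star_zero,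
          zero_mul, zero_add]
      rw [← h2, ← add_mul]
      congr 1
      exact sub_eq_of_eq_add' (by rw [← add_assoc]; exact hsumr.symm)
    rw [h1]
    refine (norm_add_le _ _).trans (add_le_add hm2 ?_)
    refine (norm_mul_le_of_le' hnkr (norm_mul_le_of_le' (hstar E).le
      (by rwa [hstar] : ‖star B‖ ≤ β))).trans (one_mul _).le
  have hτ : ‖(A + E) * (1 - qr)‖ ≤ σ p + ‖E‖ := by
    have h1 : (A + E) * (1 - qr) = svdSum u' v' (fun i => t i) Jᶜ := by
      rw [mul_sub, mul_one, hTq, hAE, sub_eq_iff_eq_add']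
      exact (Finset.sum_add_sum_compl J _).symm
    rw [h1]
    have h0 : 0 ≤ σ p + ‖E‖ := add_nonneg (hσ0 p) (norm_nonneg E)
    refine norm_svdSum_le hu' hv' h0 fun i hi => ?_
    have hi' : p ≤ (i : ℕ) := by simpa [hJ, mem_head] using hi
    rw [abs_of_nonneg (ht0 _)]
    exact (ht hi').trans (singularValue_succ_le hu hv hu' hv' hσ hσ0 ht ht0
      (hi'.trans_lt i.isLt) hA hAE)
  exact norm_sub_leading_le hsuml (hAp.trans hpA.symm) (norm_famProj_le hu' _)
    (norm_famProj_le hv _) (norm_one_sub_famProj_le hv _) snl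
    (isStarProjection_famProj hu _).isIdempotentElem.eq sql
    (isStarProjection_famProj hv' _).isIdempotentElem.eq hkla (hTq.trans hqT.symm)
    (by rw [hnla']; exact hnorm) hm1 hk hτ le_rfl

end Perturbation

/-! ### Transfer from operators to matrices. -/

section MatrixSVD

variable {n : ℕ} {M : Matrix (Fin n) (Fin n) ℝ}

theorem toEuclideanCLM_sum_smul_vecMulVec {ι : Type*} (u v : ι → EuclideanSpace ℝ (Fin n))
    (c : ι → ℝ) (I : Finset ι) :
    Matrix.toEuclideanCLM (𝕜 := ℝ) (∑ i ∈ I, c i • Matrix.vecMulVec (u i).ofLp (v i).ofLp) =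
      svdSum u v c I := by
  rw [map_sum, svdSum]
  refine Finset.sum_congr rfl fun i _ => ?_
  rw [map_smul]
  congr 1
  ext z j
  simp [Matrix.vecMulVec_mulVec, InnerProductSpace.rankOne_apply, PiLp.inner_apply, dotProduct,
    mul_comm]

theorem sv_antitone (M : Matrix (Fin n) (Fin n) ℝ) :
    Antitone (Matrix.toEuclideanLin M).singularValues :=
  LinearMap.singularValues_antitone _

theorem lt_rank_of_singularValues_pos {i : ℕ}
    (h : 0 < (Matrix.toEuclideanLin M).singularValues i) : i < M.rank := by
  rw [LinearMap.singularValues_pos_iff_lt_finrank_range] at h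
  rwa [Matrix.rank_eq_finrank_range_toLin M (EuclideanSpace.basisFun _ ℝ).toBasis
    (EuclideanSpace.basisFun _ ℝ).toBasis]

theorem SVD.abs_le_x (S : SVD M) (E : Matrix (Fin n) (Fin n) ℝ) (i j : Fin M.rank) :
    |(S.u i).ofLp ⬝ᵥ (E *ᵥ (S.v j).ofLp)| ≤ S.x E :=
  le_ciSup (f := fun q : Fin M.rank × Fin M.rank =>
    |(S.u q.1).ofLp ⬝ᵥ (E *ᵥ (S.v q.2).ofLp)|) (Set.finite_range _).bddAbove (i, j)

theorem SVD.x_nonneg (S : SVD M) (E : Matrix (Fin n) (Fin n) ℝ) : 0 ≤ S.x E :=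
  Real.iSup_nonneg fun _ => abs_nonneg _

theorem SVD.y_nonneg (S : SVD M) (E : Matrix (Fin n) (Fin n) ℝ) : 0 ≤ S.y E :=
  Real.iSup_nonneg fun _ => (abs_nonneg _).trans (le_max_left _ _)

theorem SVD.max_le_y_of_lt (S : SVD M) (E : Matrix (Fin n) (Fin n) ℝ) {i j : Fin M.rank}
    (h : i < j) :
    max |(E *ᵥ (S.v i).ofLp) ⬝ᵥ (E *ᵥ (S.v j).ofLp)|
      |(Eᵀ *ᵥ (S.u i).ofLp) ⬝ᵥ (Eᵀ *ᵥ (S.u j).ofLp)| ≤ S.y E :=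
  le_ciSup (f := fun q : {q : Fin M.rank × Fin M.rank // q.1 < q.2} =>
    max |(E *ᵥ (S.v q.1.1).ofLp) ⬝ᵥ (E *ᵥ (S.v q.1.2).ofLp)|
      |(Eᵀ *ᵥ (S.u q.1.1).ofLp) ⬝ᵥ (Eᵀ *ᵥ (S.u q.1.2).ofLp)|)
    (Set.finite_range _).bddAbove ⟨(i, j), h⟩

theorem SVD.max_le_y (S : SVD M) (E : Matrix (Fin n) (Fin n) ℝ) {i j : Fin M.rank}
    (h : i ≠ j) :
    max |(E *ᵥ (S.v i).ofLp) ⬝ᵥ (E *ᵥ (S.v j).ofLp)|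
      |(Eᵀ *ᵥ (S.u i).ofLp) ⬝ᵥ (Eᵀ *ᵥ (S.u j).ofLp)| ≤ S.y E := by
  rcases h.lt_or_gt with h | h
  · exact S.max_le_y_of_lt E h
  · rw [dotProduct_comm, dotProduct_comm (Eᵀ *ᵥ _)]
    exact S.max_le_y_of_lt E h

theorem star_toEuclideanCLM (E : Matrix (Fin n) (Fin n) ℝ) :
    star (Matrix.toEuclideanCLM (𝕜 := ℝ) E) = Matrix.toEuclideanCLM (𝕜 := ℝ) Eᵀ := by
  rw [← map_star, Matrix.star_eq_conjTranspose, Matrix.conjTranspose_eq_transpose_of_trivial]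

theorem inner_star_mul_toEuclideanCLM (E : Matrix (Fin n) (Fin n) ℝ)
    (a b : EuclideanSpace ℝ (Fin n)) :
    inner ℝ a ((star (Matrix.toEuclideanCLM (𝕜 := ℝ) E) * Matrix.toEuclideanCLM (𝕜 := ℝ) E) b) =
      (E *ᵥ a.ofLp) ⬝ᵥ (E *ᵥ b.ofLp) := by
  rw [star_toEuclideanCLM, ← map_mul, Matrix.inner_toEuclideanCLM, ← Matrix.mulVec_mulVec,
    Matrix.dotProduct_mulVec, Matrix.vecMul_transpose]

/-- Perturbation of the best rank `p` approximation of a square matrix. -/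
theorem SVD.norm_approx_sub_approx_le {A E : Matrix (Fin n) (Fin n) ℝ} (S : SVD A)
    (T : SVD (A + E)) {p : ℕ} (hp : 1 ≤ p) (hpr : p ≤ A.rank) (hgap : 0 < gap A p)
    (hxδ : A.rank * S.x E ≤ gap A p / 24) (hε : ‖E‖ ≤ sv A p / 24)
    (hε2 : ‖E‖ ^ 2 ≤ sv A p * gap A p / 576) :
    ‖T.approx p - S.approx p‖ ≤
      8 * (‖E‖ + sv A p * (A.rank * S.x E) / gap A p + A.rank * S.y E / gap A p) := by
  rw [← Matrix.l2_opNorm_toEuclideanCLM (T.approx p - S.approx p), map_sub,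
    ← Matrix.l2_opNorm_toEuclideanCLM E]
  rw [← Matrix.l2_opNorm_toEuclideanCLM E] at hε hε2
  have hT : Matrix.toEuclideanCLM (𝕜 := ℝ) (T.approx p) = svdSum T.u T.v
      (fun i => (Matrix.toEuclideanLin (A + E)).singularValues i) (head _ p) :=
    toEuclideanCLM_sum_smul_vecMulVec _ _ _ _
  have hS : Matrix.toEuclideanCLM (𝕜 := ℝ) (S.approx p) = svdSum S.u S.v
      (fun i => (Matrix.toEuclideanLin A).singularValues i) (head _ p) :=
    toEuclideanCLM_sum_smul_vecMulVec _ _ _ _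
  have hTd : Matrix.toEuclideanCLM (𝕜 := ℝ) (A + E) = svdSum T.u T.v
      (fun i => (Matrix.toEuclideanLin (A + E)).singularValues i) Finset.univ :=
    (congrArg _ T.decomp).trans (toEuclideanCLM_sum_smul_vecMulVec _ _ _ _)
  have hSd : Matrix.toEuclideanCLM (𝕜 := ℝ) A = svdSum S.u S.v
      (fun i => (Matrix.toEuclideanLin A).singularValues i) Finset.univ :=
    (congrArg _ S.decomp).trans (toEuclideanCLM_sum_smul_vecMulVec _ _ _ _)
  rw [hT, hS]
  refine norm_svdSum_head_sub_le S.orthonormal_u S.orthonormal_v T.orthonormal_u T.orthonormal_v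
    (sv_antitone A) (LinearMap.singularValues_nonneg _) (sv_antitone (A + E))
    (LinearMap.singularValues_nonneg _) (fun i => lt_rank_of_singularValues_pos) hp hpr hSd
    (by rw [← map_add, hTd]) (S.x_nonneg E) (S.y_nonneg E) (fun i j => ?_) (fun i j hij => ?_)
    (fun i j hij => ?_) hgap hxδ hε hε2
  · rw [Matrix.inner_toEuclideanCLM]
    exact S.abs_le_x E i j
  · have := inner_star_mul_toEuclideanCLM Eᵀ (S.u i) (S.u j)
    rw [star_toEuclideanCLM, Matrix.transpose_transpose] at this
    rw [star_toEuclideanCLM, this]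
    exact (le_max_right _ _).trans (S.max_le_y E hij)
  · rw [inner_star_mul_toEuclideanCLM]
    exact (le_max_left _ _).trans (S.max_le_y E hij)

end MatrixSVD

end LowRank

end

/-! ### Deduction of the stated bound. -/

theorem mainTheorem3 {n : ℕ} (A E : Matrix (Fin n) (Fin n) ℝ)
    (hA : A.PosSemidef) (hE : E.IsSymm)
    (S : LowRank.SVD A) (T : LowRank.SVD (A + E))
    (r p : ℕ) (hr : A.rank = r) (hp : 1 ≤ p) (hpr : p ≤ r)
    (hgap : 0 < LowRank.gap A p)
    (hsmall : max (p * ‖E‖ / LowRank.sv A p)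
        (max ((r : ℝ) ^ 2 * S.x E / LowRank.gap A p)
          (√(r : ℝ) * ‖E‖ / √(LowRank.sv A p * LowRank.gap A p))) ≤ 1 / 24) :
    ‖T.approx p - S.approx p‖ ≤
      8 * LowRank.sv A p *
        (‖E‖ / LowRank.sv A p + r * S.x E / LowRank.gap A p +
          (r : ℝ) ^ 2 * S.y E / (LowRank.sv A p * LowRank.gap A p)) := by
  subst hr
  have hx := S.x_nonneg E
  have hy := S.y_nonneg E
  have hσ : 0 < LowRank.sv A p := by
    have h1 : 0 ≤ LowRank.sv A (p + 1) := LinearMap.singularValues_nonneg _ _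
    have h2 : 0 < LowRank.sv A p - LowRank.sv A (p + 1) := hgap
    linarith
  have hp' : (1 : ℝ) ≤ p := by exact_mod_cast hp
  have hr' : (1 : ℝ) ≤ A.rank := by exact_mod_cast hp.trans hpr
  have h1 := (le_max_left _ _).trans hsmall
  have h2 := (le_max_left _ _).trans ((le_max_right _ _).trans hsmall)
  have h3 := (le_max_right _ _).trans ((le_max_right _ _).trans hsmall)
  rw [div_le_iff₀ hσ] at h1
  rw [div_le_iff₀ hgap] at h2
  rw [div_le_iff₀ (Real.sqrt_pos.mpr (mul_pos hσ hgap))] at h3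
  -- Since `p, r ≥ 1`, the three smallness conditions imply the weaker forms used by the operator
  -- bound; `576 = 24²`.
  have hε : ‖E‖ ≤ LowRank.sv A p / 24 := by
    have := mul_le_mul_of_nonneg_right hp' (norm_nonneg E)
    linarith
  have hxδ : A.rank * S.x E ≤ LowRank.gap A p / 24 := by
    have : A.rank * S.x E ≤ (A.rank : ℝ) ^ 2 * S.x E :=
      mul_le_mul_of_nonneg_right (le_self_pow₀ hr' two_ne_zero) hx
    linarith
  have hε2 : ‖E‖ ^ 2 ≤ LowRank.sv A p * LowRank.gap A p / 576 := by
    have h4 := pow_le_pow_left₀ (by positivity) h3 2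
    rw [mul_pow, mul_pow, Real.sq_sqrt (by positivity), Real.sq_sqrt (by positivity)] at h4
    have := mul_le_mul_of_nonneg_right hr' (sq_nonneg ‖E‖)
    linarith
  refine (S.norm_approx_sub_approx_le T hp hpr hgap hxδ hε hε2).trans ?_
  have h5 : A.rank * S.y E / LowRank.gap A p ≤ (A.rank : ℝ) ^ 2 * S.y E / LowRank.gap A p := by
    gcongr
    exact le_self_pow₀ hr' two_ne_zero
  have h6 : 8 * LowRank.sv A p * (‖E‖ / LowRank.sv A p + A.rank * S.x E / LowRank.gap A p +
      (A.rank : ℝ) ^ 2 * S.y E / (LowRank.sv A p * LowRank.gap A p)) =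
      8 * (‖E‖ + LowRank.sv A p * (A.rank * S.x E) / LowRank.gap A p +
        (A.rank : ℝ) ^ 2 * S.y E / LowRank.gap A p) := by
    field_simp
  rw [h6]
  linarith
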